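/- **Setting.** Let $\mathcal A$ be a set of atomic constants, to which a constant $\bot$ is added, and let $\{X_i : i\in I\}$ be a finite set of type variables. Types are generated from the constants, $\bot$ and the variables $X_i$ by the arrow $U\to V$; write $\neg U$ for $U\to\bot$. Let $(F_i)_{i\in I}$ be a family of types and let $\approx$ be the least congruence on types (equivalence relation compatible with $\to$) such that $X_i\approx F_i$ for every $i\in I$. Assume that $\approx$ is *good*: for all $i\in I$ and all types $T$, if $X_i\approx T$ then every occurrence of $X_i$ in $T$ is positive (i.e. lies to the left of an even number of arrows). The terms of the $\lambda\mu$-calculus (de Groote style) are generated, from $\lambda$-variables $x$ and $\mu$-variables $\alpha$, by $M ::= x \mid \lambda x\,M \mid (M\;M)\mid \mu\alpha\,M\mid(\alpha\;M)$, and are considered up to renaming of bound variables. Reduction $\triangleright$ is the least relation compatible with contexts such that $(\lambda x\,M\;\,N)\triangleright M[x:=N]$ and $(\mu\alpha\,M\;\,N)\triangleright\mu\alpha\,M[\alpha=N]$, where $M[\alpha=N]$ is obtained from $M$ by replacing recursively each subterm $(\alpha\;P)$ by $(\alpha\;(P\;N))$. $SN$ is the set of strongly normalizing terms, i.e. those from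 which no infinite reduction starts. A context $\Gamma$ is a finite set of declarations $x:U$ and $\alpha:\neg U$ (at most one for each variable). The typing rules are: - $\Gamma,x:U\vdash x:U$; - if $\Gamma\vdash M:U$ and $U\approx V$, then $\Gamma\vdash M:V$; - if $\Gamma,x:U\vdash M:V$, then $\Gamma\vdash\lambda x\,M:U\to V$; - if $\Gamma\vdash M_1:U\to V$ and $\Gamma\vdash M_2:U$, then $\Gamma\vdash(M_1\;M_2):V$; - if $\Gamma,\alpha:\neg U\vdash M:\bot$, then $\Gamma\vdash\mu\alpha\,M:U$; - if $\Gamma,\alpha:\neg U\vdash M:U$, then $\Gamma,\alpha:\neg U\vdash(\alpha\;M):\bot$. For a set $\mathcal E$ of types, let $H[\mathcal E]$ be the property: for all $M,N\in SN$ and all $\Gamma,U,V$ with $U\in\mathcal E$, $\Gamma,x:U\vdash M:V$ and $\Gamma\vdash N:U$, one has $M[x:=N]\in SN$. For $Y\subseteq I$, let $\mathcal T(Y)$ be the set of types all of whose type variables are among the $X_i$, $i\in Y$. **Theorem.** Under these assumptions: 1. For every $Y\subseteq I$, if $H[\{X_i\}]$ holds for each $i\in Y$, then $H[\mathcal T(Y)]$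 holds. 2. For every $i\in I$: if $\Gamma,x:X_i\vdash M:U$, $\Gamma\vdash N:X_i$ and $M,N\in SN$, then $M[x:=N]\in SN$. 3. Every typable term is strongly normalizing: if $\Gamma\vdash M:U$, then $M\in SN$. -/

import Mathlib

namespace LamMu

/-- Types over a set `A` of atomic constants (to which `⊥` is added) and the type variables
`X i`, `i : I`. -/
inductive Ty (A I : Type*) where
  | bot : Ty A I
  | atom : A → Ty A I
  | var : I → Ty A I
  | arr : Ty A I → Ty A I → Ty A I

/-- The set of (indices of) type variables occurring in a type. -/
def Ty.vars {A I : Type*} : Ty A I → Set I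
  | .bot => ∅
  | .atom _ => ∅
  | .var i => {i}
  | .arr U V => U.vars ∪ V.vars

/-- The set of the types all of whose type variables have their index in `Y`. -/
def typesOver (A : Type*) {I : Type*} (Y : Set I) : Set (Ty A I) := {T | T.vars ⊆ Y}

/-- The least congruence on types such that `X i ≈ F i` for every `i`. -/
inductive TyEq {A I : Type*} (F : I → Ty A I) : Ty A I → Ty A I → Prop
  | eqn (i : I) : TyEq F (.var i) (F i)
  | refl (U : Ty A I) : TyEq F U U
  | symm {U V : Ty A I} : TyEq F U V → TyEq F V U
  | trans {U V W : Ty A I} : TyEq F U V → TyEq F V W → TyEq F U W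
  | arr {U U' V V' : Ty A I} :
      TyEq F U U' → TyEq F V V' → TyEq F (.arr U V) (.arr U' V')

/-- `Polar X true T`: every occurrence of the variable `X` in `T` is positive.
`Polar X false T`: every occurrence of the variable `X` in `T` is negative. -/
inductive Polar {A I : Type*} (X : I) : Bool → Ty A I → Prop
  | self : Polar X true (.var X)
  | var (s : Bool) {Y : I} : Y ≠ X → Polar X s (.var Y)
  | bot (s : Bool) : Polar X s .bot
  | atom (s : Bool) (a : A) : Polar X s (.atom a)
  | arr {s : Bool} {U V : Ty A I} : Polar X (!s) U → Polar X s V → Polar X s (.arr U V)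

/-- A congruence is good if `X ≈ T` implies that `X` occurs only positively in `T`. -/
def Good {A I : Type*} (r : Ty A I → Ty A I → Prop) : Prop :=
  ∀ (X : I) (T : Ty A I), r (.var X) T → Polar X true T

/-- λμ-terms up to renaming of bound variables, in de Bruijn notation: the λ-variables and the
μ-variables are numbered separately; `lam` binds the λ-variable `0`, `mu` binds the μ-variable
`0`; `named a M` is the term `(α M)`, where `α` is the μ-variable number `a`. A `named` term may
occur anywhere, and `mu` may be followed by any term. -/
inductive Term where
  | var : ℕ → Term
  | lam : Term → Term
  | app : Term → Term → Term
  | mu : Term → Term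
  | named : ℕ → Term → Term

/-- A renaming, lifted under a binder of the same sort. -/
def liftRen (f : ℕ → ℕ) : ℕ → ℕ
  | 0 => 0
  | n + 1 => f n + 1

/-- Rename the free λ-variables along `f` and the free μ-variables along `g`. -/
def Term.rename : (ℕ → ℕ) → (ℕ → ℕ) → Term → Term
  | f, _, .var x => .var (f x)
  | f, g, .lam M => .lam (M.rename (liftRen f) g)
  | f, g, .app M N => .app (M.rename f g) (N.rename f g)
  | f, g, .mu M => .mu (M.rename f (liftRen g))
  | f, g, .named a M => .named (g a) (M.rename f g)

/-- Weakening of a term by a fresh λ-variable `0`. -/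
def Term.shiftLam (M : Term) : Term := M.rename Nat.succ id

/-- Weakening of a term by a fresh μ-variable `0`. -/
def Term.shiftMu (M : Term) : Term := M.rename id Nat.succ

/-- A λ-substitution, lifted under a `lam`. -/
def liftSubst (σ : ℕ → Term) : ℕ → Term
  | 0 => .var 0
  | n + 1 => (σ n).shiftLam

/-- Capture-avoiding simultaneous substitution of terms for λ-variables. -/
def Term.subst : (ℕ → Term) → Term → Term
  | σ, .var x => σ x
  | σ, .lam M => .lam (M.subst (liftSubst σ))
  | σ, .app M N => .app (M.subst σ) (N.subst σ)
  | σ, .mu M => .mu (M.subst fun x => (σ x).shiftMu)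
  | σ, .named a M => .named a (M.subst σ)

/-- The substitution that sends the λ-variable `0` to `N` and `n + 1` to `n`. -/
def single (N : Term) : ℕ → Term
  | 0 => N
  | n + 1 => .var n

/-- `M.inst N` is `M[x:=N]`, where `x` is the λ-variable `0` of `M`, which disappears. -/
def Term.inst (M N : Term) : Term := M.subst (single N)

/-- `M.muSubst a N` is `M[α=N]`, where `α` is the μ-variable number `a`: every subterm `(α P)` is
replaced by `(α (P N))`, recursively. The variable `α` does not disappear. -/
def Term.muSubst : Term → ℕ → Term → Term
  | .var x, _, _ => .var x
  | .lam M, a, N => .lam (M.muSubst a N.shiftLam)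
  | .app M P, a, N => .app (M.muSubst a N) (P.muSubst a N)
  | .mu M, a, N => .mu (M.muSubst (a + 1) N.shiftMu)
  | .named b M, a, N =>
      if b = a then .named b (.app (M.muSubst a N) N) else .named b (M.muSubst a N)

/-- One-step reduction: the least relation compatible with contexts that contains
`(λx M N) ▷ M[x:=N]` and `(μα M N) ▷ μα M[α=N]`. -/
inductive Step : Term → Term → Prop
  | beta (M N : Term) : Step (.app (.lam M) N) (M.inst N)
  | mu_app (M N : Term) : Step (.app (.mu M) N) (.mu (M.muSubst 0 N.shiftMu))
  | lam {M M' : Term} : Step M M' → Step (.lam M) (.lam M')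
  | app_left {M M' : Term} (N : Term) : Step M M' → Step (.app M N) (.app M' N)
  | app_right (M : Term) {N N' : Term} : Step N N' → Step (.app M N) (.app M N')
  | mu {M M' : Term} : Step M M' → Step (.mu M) (.mu M')
  | named (a : ℕ) {M M' : Term} : Step M M' → Step (.named a M) (.named a M')

/-- Strong normalization: there is no infinite reduction starting from the term. -/
def SN (M : Term) : Prop := Acc (fun P Q => Step Q P) M

/-- The typing judgement `Γ ; Δ ⊢ M : U` with respect to a congruence `r` on types. The `n`-th
entry `U` of `Γ` is the declaration `x : U` of the λ-variable number `n`; the `a`-th entry `U` of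
`Δ` is the declaration `α : ¬U` (that is, `α : U → ⊥`) of the μ-variable number `a`. -/
inductive HasType {A I : Type*} (r : Ty A I → Ty A I → Prop) :
    List (Ty A I) → List (Ty A I) → Term → Ty A I → Prop
  | ax {Γ Δ : List (Ty A I)} {n : ℕ} {U : Ty A I} :
      Γ[n]? = some U → HasType r Γ Δ (.var n) U
  | conv {Γ Δ : List (Ty A I)} {M : Term} {U V : Ty A I} :
      HasType r Γ Δ M U → r U V → HasType r Γ Δ M V
  | lam {Γ Δ : List (Ty A I)} {M : Term} {U V : Ty A I} :
      HasType r (U :: Γ) Δ M V → HasType r Γ Δ (.lam M) (.arr U V)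
  | app {Γ Δ : List (Ty A I)} {M N : Term} {U V : Ty A I} :
      HasType r Γ Δ M (.arr U V) → HasType r Γ Δ N U → HasType r Γ Δ (.app M N) V
  | mu {Γ Δ : List (Ty A I)} {M : Term} {U : Ty A I} :
      HasType r Γ (U :: Δ) M .bot → HasType r Γ Δ (.mu M) U
  | named {Γ Δ : List (Ty A I)} {a : ℕ} {M : Term} {U : Ty A I} :
      Δ[a]? = some U → HasType r Γ Δ M U → HasType r Γ Δ (.named a M) .bot

/-- The property `H[𝓔]` of a set `𝓔` of types: if `M` and `N` are strongly normalizing,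
`Γ, x : U ⊢ M : V` and `Γ ⊢ N : U` with `U ∈ 𝓔`, then `M[x:=N]` is strongly normalizing. -/
def SubstSN {A I : Type*} (r : Ty A I → Ty A I → Prop) (𝓔 : Set (Ty A I)) : Prop :=
  ∀ (Γ Δ : List (Ty A I)) (M N : Term) (U V : Ty A I), U ∈ 𝓔 → SN M → SN N →
    HasType r (U :: Γ) Δ M V → HasType r Γ Δ N U → SN (M.inst N)

end LamMu

/-! All three claims follow from strong normalization of typable terms: if `M` and `N` are typed as
in a substitution, `M[x:=N]` is a one-step reduct of the typable term `(λx M) N`.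

Normalization is proved by reducibility. A type is interpreted by a set of strongly normalizing
stacks of arguments that contains the empty stack; its realizers are the terms that are strongly
normalizing against every such stack. A μ-variable is then interpreted by a stack, and
`HasType.sub_mem` shows that a typed term, after substituting realizers for its λ-variables and
stacks for its μ-variables, is a realizer. The closure properties needed are `SN.lam_apps` and
`SN.mu_apps`.

The conversion rule requires candidates `v i` with `v i = interp v (F i)`. The arrow is antitone on
the left and monotone on the right, so signs of occurrences control monotonicity. Goodness says that
no unknown depends negatively on itself, even through the other equations; a finite system of this
kind is solved by eliminating one unknown at a time with least fixed points (`exists_solution`). -/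

namespace LamMu

/-! ### Simultaneous substitution of terms for λ-variables and of stacks for μ-variables -/

/-- The application of a term to a stack (list) of arguments. -/
def Term.apps (H : Term) (π : List Term) : Term := π.foldl .app H

@[simp] theorem Term.apps_nil (H : Term) : H.apps [] = H := rfl

@[simp] theorem Term.apps_cons (H N : Term) (π : List Term) :
    H.apps (N :: π) = (Term.app H N).apps π := rfl

theorem Term.apps_append (H : Term) (π ρ : List Term) : H.apps (π ++ ρ) = (H.apps π).apps ρ := by
  simp [Term.apps]

/-- The identity substitution for μ-variables. -/
def idMu : ℕ → ℕ × List Term := fun a => (a, [])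

/-- A μ-substitution, lifted under a `lam`. -/
def shiftLamMu (κ : ℕ → ℕ × List Term) : ℕ → ℕ × List Term :=
  fun a => ((κ a).1, (κ a).2.map Term.shiftLam)

/-- A μ-substitution, lifted under a `mu`. -/
def liftMu (κ : ℕ → ℕ × List Term) : ℕ → ℕ × List Term
  | 0 => (0, [])
  | n + 1 => ((κ n).1 + 1, (κ n).2.map Term.shiftMu)

/-- The simultaneous substitution that sends the λ-variable `x` to `σ x`, and each subterm
`(α M)` to `(β (M π))`, where `κ α = (β, π)`. -/
def Term.sub : (ℕ → Term) → (ℕ → ℕ × List Term) → Term → Term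
  | σ, _, .var x => σ x
  | σ, κ, .lam M => .lam (M.sub (liftSubst σ) (shiftLamMu κ))
  | σ, κ, .app M N => .app (M.sub σ κ) (N.sub σ κ)
  | σ, κ, .mu M => .mu (M.sub (fun x => (σ x).shiftMu) (liftMu κ))
  | σ, κ, .named a M => .named (κ a).1 ((M.sub σ κ).apps (κ a).2)

theorem Term.rename_apps (f g : ℕ → ℕ) (H : Term) (π : List Term) :
    (H.apps π).rename f g = (H.rename f g).apps (π.map (Term.rename f g)) := by
  induction π generalizing H with
  | nil => rfl
  | cons N π ih => simp [ih, Term.rename]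

theorem Term.sub_apps (σ : ℕ → Term) (κ : ℕ → ℕ × List Term) (H : Term) (π : List Term) :
    (H.apps π).sub σ κ = (H.sub σ κ).apps (π.map (Term.sub σ κ)) := by
  induction π generalizing H with
  | nil => rfl
  | cons N π ih => simp [ih, Term.sub]

theorem liftRen_comp (f f' : ℕ → ℕ) : liftRen f' ∘ liftRen f = liftRen (f' ∘ f) := by
  funext n; cases n <;> rfl

theorem Term.rename_rename (M : Term) (f g f' g' : ℕ → ℕ) :
    (M.rename f g).rename f' g' = M.rename (f' ∘ f) (g' ∘ g) := by
  induction M generalizing f g f' g' <;> simp_all [Term.rename, liftRen_comp]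

theorem Term.shiftLam_rename (M : Term) (f g : ℕ → ℕ) :
    M.shiftLam.rename (liftRen f) g = (M.rename f g).shiftLam := by
  simp only [Term.shiftLam, Term.rename_rename]; rfl

theorem Term.shiftMu_rename (M : Term) (f g : ℕ → ℕ) :
    M.shiftMu.rename f (liftRen g) = (M.rename f g).shiftMu := by
  simp only [Term.shiftMu, Term.rename_rename]; rfl

theorem Term.sub_rename (M : Term) (f g : ℕ → ℕ) (σ : ℕ → Term) (κ : ℕ → ℕ × List Term) :
    (M.rename f g).sub σ κ = M.sub (σ ∘ f) (κ ∘ g) := by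
  induction M generalizing f g σ κ with
  | var x => rfl
  | lam M ih =>
    simp only [Term.rename, Term.sub, ih]
    congr 2; funext n; cases n <;> rfl
  | app M N ih₁ ih₂ => simp only [Term.rename, Term.sub, ih₁, ih₂]
  | mu M ih =>
    simp only [Term.rename, Term.sub, ih]
    congr 2; funext n; cases n <;> rfl
  | named a M ih => simp only [Term.rename, Term.sub, ih]; rfl

theorem Term.rename_sub (M : Term) (f g : ℕ → ℕ) (σ : ℕ → Term) (κ : ℕ → ℕ × List Term) :
    (M.sub σ κ).rename f g = M.sub (fun x => (σ x).rename f g)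
      (fun a => (g (κ a).1, (κ a).2.map (Term.rename f g))) := by
  induction M generalizing f g σ κ with
  | var x => rfl
  | lam M ih =>
    simp only [Term.rename, Term.sub, ih]
    congr 2
    · funext n; cases n
      · rfl
      · simp [liftSubst, Term.shiftLam_rename]
    · funext n
      simp [shiftLamMu, Term.shiftLam_rename]
  | app M N ih₁ ih₂ => simp only [Term.rename, Term.sub, ih₁, ih₂]
  | mu M ih =>
    simp only [Term.rename, Term.sub, ih]
    congr 2
    · funext n; simp [Term.shiftMu_rename]
    · funext n; cases n
      · rfl
      · simp [liftMu, Term.shiftMu_rename, liftRen]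
  | named a M ih => simp only [Term.rename, Term.sub, ih, Term.rename_apps]

theorem Term.shiftLam_sub (M : Term) (σ : ℕ → Term) (κ : ℕ → ℕ × List Term) :
    M.shiftLam.sub (liftSubst σ) (shiftLamMu κ) = (M.sub σ κ).shiftLam := by
  simp only [Term.shiftLam, Term.sub_rename, Term.rename_sub]; rfl

theorem Term.shiftMu_sub (M : Term) (σ : ℕ → Term) (κ : ℕ → ℕ × List Term) :
    M.shiftMu.sub (fun x => (σ x).shiftMu) (liftMu κ) = (M.sub σ κ).shiftMu := by
  simp only [Term.shiftMu, Term.sub_rename, Term.rename_sub]; rfl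

/-- Stacks compose by concatenation: the arguments pushed by the first substitution stand closer to
the head. -/
theorem Term.sub_sub (M : Term) (σ σ' : ℕ → Term) (κ κ' : ℕ → ℕ × List Term) :
    (M.sub σ κ).sub σ' κ' = M.sub (fun x => (σ x).sub σ' κ')
      (fun a => ((κ' (κ a).1).1, (κ a).2.map (Term.sub σ' κ') ++ (κ' (κ a).1).2)) := by
  induction M generalizing σ σ' κ κ' with
  | var x => rfl
  | lam M ih =>
    simp only [Term.sub, ih]
    congr 2
    · funext n; cases n
      · rfl
      · simp [liftSubst, Term.shiftLam_sub]
    · funext n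
      simp [shiftLamMu, Term.shiftLam_sub]
  | app M N ih₁ ih₂ => simp only [Term.sub, ih₁, ih₂]
  | mu M ih =>
    simp only [Term.sub, ih]
    congr 2
    · funext n; simp [Term.shiftMu_sub]
    · funext n; cases n
      · rfl
      · simp [liftMu, Term.shiftMu_sub]
  | named a M ih => simp only [Term.sub, ih, Term.sub_apps, Term.apps_append]

theorem shiftLamMu_idMu : shiftLamMu idMu = idMu := rfl

theorem liftMu_idMu : liftMu idMu = idMu := by
  funext n; cases n <;> rfl

theorem Term.sub_id (M : Term) : M.sub .var idMu = M := by
  have h : liftSubst Term.var = .var := by funext n; cases n <;> rfl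
  have h' : (fun x => (Term.var x).shiftMu) = .var := rfl
  induction M <;> simp_all [Term.sub, shiftLamMu_idMu, liftMu_idMu]
  simp_all [idMu]

theorem Term.rename_eq_sub (M : Term) (f g : ℕ → ℕ) :
    M.rename f g = M.sub (fun x => .var (f x)) (fun a => (g a, [])) := by
  conv_lhs => rw [← M.sub_id, Term.rename_sub]
  rfl

theorem Term.subst_eq_sub (M : Term) (σ : ℕ → Term) : M.subst σ = M.sub σ idMu := by
  induction M generalizing σ <;> simp_all [Term.sub, Term.subst, shiftLamMu_idMu, liftMu_idMu]
  simp [idMu]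

/-- The μ-substitution that applies the `a`-named subterms to the stack `π`. -/
def pushMu (a : ℕ) (π : List Term) : ℕ → ℕ × List Term :=
  fun b => (b, if b = a then π else [])

theorem Term.muSubst_eq_sub (M : Term) (a : ℕ) (N : Term) :
    M.muSubst a N = M.sub .var (pushMu a [N]) := by
  have h : liftSubst Term.var = .var := by funext n; cases n <;> rfl
  induction M generalizing a N with
  | var x => rfl
  | lam M ih =>
    simp only [Term.muSubst, Term.sub, ih, h]
    congr 2; funext n; simp only [shiftLamMu, pushMu]; split_ifs <;> rfl
  | app M P ih₁ ih₂ => simp only [Term.muSubst, Term.sub, ih₁, ih₂]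
  | mu M ih =>
    simp only [Term.muSubst, Term.sub, ih]
    congr 2; funext n; cases n
    · simp [liftMu, pushMu]
    · simp only [liftMu, pushMu, Nat.add_right_cancel_iff]; split_ifs <;> rfl
  | named b M ih =>
    simp only [Term.muSubst, Term.sub, ih, pushMu]
    split_ifs <;> rfl

theorem Term.inst_eq_sub (M N : Term) : M.inst N = M.sub (single N) idMu :=
  M.subst_eq_sub _

theorem Term.sub_lift_inst (M N : Term) (σ : ℕ → Term) (κ : ℕ → ℕ × List Term) :
    (M.sub (liftSubst σ) (shiftLamMu κ)).inst N =
      M.sub (fun | 0 => N | n + 1 => σ n) κ := by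
  have h (P : Term) : P.shiftLam.sub (single N) idMu = P := by
    rw [Term.shiftLam, Term.sub_rename]; exact P.sub_id
  rw [Term.inst_eq_sub, Term.sub_sub]
  congr 1
  · funext n; cases n
    · rfl
    · exact h _
  · funext n
    simp [shiftLamMu, idMu, Function.comp_def, h]

theorem Term.shiftMu_sub_push (P : Term) (π : List Term) :
    P.shiftMu.sub .var (pushMu 0 π) = P.shiftMu := by
  conv_rhs => rw [Term.shiftMu, Term.rename_eq_sub]
  rw [Term.shiftMu, Term.sub_rename]
  rfl

theorem Term.sub_push (M : Term) (π : List Term) (σ : ℕ → Term) (κ : ℕ → ℕ × List Term) :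
    (M.sub (fun x => (σ x).shiftMu) (liftMu κ)).sub .var (pushMu 0 (π.map Term.shiftMu)) =
      M.sub (fun x => (σ x).shiftMu)
        (fun | 0 => (0, π.map Term.shiftMu)
             | n + 1 => ((κ n).1 + 1, (κ n).2.map Term.shiftMu)) := by
  rw [Term.sub_sub]
  congr 1
  · funext n; exact Term.shiftMu_sub_push _ _
  · funext n; cases n
    · rfl
    · simp [liftMu, pushMu, Term.shiftMu_sub_push]

/-- Passing `N` and then `π` to a μ-abstraction amounts to passing `N :: π` at once, since the bound
name is not free in `N`. -/
theorem Term.muSubst_push (M N : Term) (π : List Term) :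
    (M.muSubst 0 N.shiftMu).sub .var (pushMu 0 (π.map Term.shiftMu)) =
      M.sub .var (pushMu 0 ((N :: π).map Term.shiftMu)) := by
  rw [Term.muSubst_eq_sub, Term.sub_sub]
  congr 1
  funext n; cases n
  · simp [pushMu, Term.shiftMu_sub_push]
  · simp [pushMu]

/-! ### Reduction and substitution -/

theorem Step.apps {M M' : Term} (h : Step M M') (π : List Term) : Step (M.apps π) (M'.apps π) := by
  induction π generalizing M M' with
  | nil => exact h
  | cons N π ih => exact ih (.app_left N h)

/-- One step is sent to exactly one step, which is what lets `SN.of_image` reflect strong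
normalization along substitutions. -/
theorem Step.sub {M M' : Term} (h : Step M M') (σ : ℕ → Term) (κ : ℕ → ℕ × List Term) :
    Step (M.sub σ κ) (M'.sub σ κ) := by
  induction h generalizing σ κ with
  | beta M N =>
    have := Step.beta (M.sub (liftSubst σ) (shiftLamMu κ)) (N.sub σ κ)
    rw [Term.sub_lift_inst] at this
    rw [Term.inst_eq_sub, Term.sub_sub]
    convert this using 1
    · rfl
    · refine congrArg₂ (fun σ κ => M.sub σ κ) ?_ rfl
      funext n; cases n <;> rfl
  | mu_app M N =>
    have := Step.mu_app (M.sub (fun x => (σ x).shiftMu) (liftMu κ)) (N.sub σ κ)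
    rw [Term.muSubst_eq_sub] at this
    have e := Term.sub_push M [N.sub σ κ] σ κ
    simp only [List.map_cons, List.map_nil] at e
    rw [e] at this
    simp only [Term.sub, Term.muSubst_eq_sub, Term.sub_sub]
    convert this using 3
    funext n; cases n
    · simp [pushMu, liftMu, Term.shiftMu_sub]
    · simp [pushMu, liftMu]
  | lam _ ih => exact .lam (ih _ _)
  | app_left N _ ih => exact .app_left _ (ih _ _)
  | app_right M _ ih => exact .app_right _ (ih _ _)
  | mu _ ih => exact .mu (ih _ _)
  | named a _ ih => exact .named _ ((ih _ _).apps _)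

theorem Step.rename {M M' : Term} (h : Step M M') (f g : ℕ → ℕ) :
    Step (M.rename f g) (M'.rename f g) := by
  simpa only [Term.rename_eq_sub] using h.sub _ _

theorem SN.of_image {φ : Term → Term} (hφ : ∀ M M', Step M M' → Step (φ M) (φ M')) {M : Term}
    (h : SN (φ M)) : SN M :=
  Subrelation.accessible (fun {_ _} h => hφ _ _ h) (InvImage.accessible φ h)

theorem SN.step {M M' : Term} (h : SN M) (hs : Step M M') : SN M' := Acc.inv h hs

/-- Reduction in any number of steps. -/
abbrev Steps : Term → Term → Prop := Relation.ReflTransGen Step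

theorem Steps.congr {φ : Term → Term} (hφ : ∀ M M', Step M M' → Step (φ M) (φ M')) {M M' : Term}
    (h : Steps M M') : Steps (φ M) (φ M') :=
  Relation.ReflTransGen.lift φ hφ _ _ h

theorem Steps.app {M M' N N' : Term} (h : Steps M M') (h' : Steps N N') :
    Steps (.app M N) (.app M' N') :=
  (Steps.congr (φ := fun M => .app M N) (fun _ _ h => .app_left N h) h).trans
    (Steps.congr (fun _ _ h => .app_right M' h) h')

theorem Steps.apps {M M' : Term} (h : Steps M M') {π π' : List Term}
    (h' : List.Forall₂ Steps π π') : Steps (M.apps π) (M'.apps π') := by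
  induction h' generalizing M M' with
  | nil => exact h
  | cons h₁ _ ih => exact ih (h.app h₁)

theorem Forall₂.map_steps {φ : Term → Term} (hφ : ∀ M M', Step M M' → Step (φ M) (φ M'))
    {π π' : List Term} (h : List.Forall₂ Steps π π') :
    List.Forall₂ Steps (π.map φ) (π'.map φ) := by
  induction h with
  | nil => exact .nil
  | cons h₁ _ ih => exact .cons (h₁.congr hφ) ih

/-- A substituted term may be copied or erased, so the number of steps is arbitrary, possibly zero.
-/
theorem Term.sub_steps (M : Term) {σ σ' : ℕ → Term} {κ κ' : ℕ → ℕ × List Term}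
    (hσ : ∀ x, Steps (σ x) (σ' x))
    (hκ : ∀ a, (κ a).1 = (κ' a).1 ∧ List.Forall₂ Steps (κ a).2 (κ' a).2) :
    Steps (M.sub σ κ) (M.sub σ' κ') := by
  induction M generalizing σ σ' κ κ' with
  | var x => exact hσ x
  | lam M ih =>
    refine Steps.congr (fun _ _ => .lam) (ih ?_ ?_)
    · rintro (_ | n)
      · exact .refl
      · exact (hσ n).congr fun _ _ h => h.rename _ _
    · exact fun a => ⟨(hκ a).1, Forall₂.map_steps (fun _ _ h => h.rename _ _) (hκ a).2⟩
  | app M N ih₁ ih₂ => exact (ih₁ hσ hκ).app (ih₂ hσ hκ)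
  | mu M ih =>
    refine Steps.congr (fun _ _ => .mu) (ih ?_ ?_)
    · exact fun x => (hσ x).congr fun _ _ h => h.rename _ _
    · rintro (_ | n)
      · exact ⟨rfl, .nil⟩
      · exact ⟨congrArg (· + 1) (hκ n).1, Forall₂.map_steps (fun _ _ h => h.rename _ _) (hκ n).2⟩
  | named a M ih =>
    simp only [Term.sub, (hκ a).1]
    exact Steps.congr (fun _ _ => .named _) ((ih hσ hκ).apps (hκ a).2)

/-! ### Strong normalization of terms applied to stacks -/

/-- Reduction of one element of a stack. -/
inductive StackStep : List Term → List Term → Prop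
  | head {N N' : Term} (π : List Term) : Step N N' → StackStep (N :: π) (N' :: π)
  | tail (N : Term) {π π' : List Term} : StackStep π π' → StackStep (N :: π) (N :: π')

/-- Strong normalization of stacks. -/
def StackSN (π : List Term) : Prop := Acc (fun π ρ => StackStep ρ π) π

theorem StackSN.nil : StackSN [] := ⟨_, fun _ h => by cases h⟩

theorem StackSN.cons {N : Term} {π : List Term} (hN : SN N) (hπ : StackSN π) :
    StackSN (N :: π) := by
  induction hN generalizing π with
  | intro N hN ihN =>
    induction hπ with
    | intro π hπ ihπ =>
      refine ⟨_, fun ρ h => ?_⟩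
      cases h with
      | head _ h => exact ihN _ h ⟨_, hπ⟩
      | tail _ h => exact ihπ _ h

theorem StackSN.tail {N : Term} {π : List Term} (h : StackSN (N :: π)) : StackSN π :=
  Subrelation.accessible (fun {_ _} h => .tail N h) (InvImage.accessible (List.cons N) h)

theorem StackStep.forall₂ {π π' : List Term} (h : StackStep π π') : List.Forall₂ Steps π π' := by
  induction h with
  | head π h => exact .cons (.single h) (List.forall₂_refl _)
  | tail N _ ih => exact .cons .refl ih

theorem StackStep.length_eq {π π' : List Term} (h : StackStep π π') : π'.length = π.length :=
  h.forall₂.length_eq.symm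

theorem Step.apps_inv {H Q : Term} {π : List Term} (h : Step (H.apps π) Q) :
    (∃ H', Step H H' ∧ Q = H'.apps π) ∨ (∃ π', StackStep π π' ∧ Q = H.apps π') ∨
    ∃ M N ρ, π = N :: ρ ∧ (H = .lam M ∧ Q = (M.inst N).apps ρ ∨
      H = .mu M ∧ Q = (Term.mu (M.muSubst 0 N.shiftMu)).apps ρ) := by
  induction π generalizing H with
  | nil => exact .inl ⟨Q, h, rfl⟩
  | cons N π ih =>
    rcases ih h with ⟨H', hs, rfl⟩ | ⟨π', hs, rfl⟩ | ⟨M, _, _, _, ⟨h, _⟩ | ⟨h, _⟩⟩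
    · cases hs with
      | beta M => exact .inr (.inr ⟨M, N, π, rfl, .inl ⟨rfl, rfl⟩⟩)
      | mu_app M => exact .inr (.inr ⟨M, N, π, rfl, .inr ⟨rfl, rfl⟩⟩)
      | app_left _ hs => exact .inl ⟨_, hs, rfl⟩
      | app_right _ hs => exact .inr (.inl ⟨_, .head _ hs, rfl⟩)
    · exact .inr (.inl ⟨_, .tail _ hs, rfl⟩)
    · cases h
    · cases h

theorem SN.var_apps (x : ℕ) {π : List Term} (hπ : StackSN π) : SN ((Term.var x).apps π) := by
  induction hπ with
  | intro π _ ih =>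
    refine ⟨_, fun Q h => ?_⟩
    rcases h.apps_inv with ⟨_, hs, _⟩ | ⟨_, hs, rfl⟩ | ⟨_, _, _, _, ⟨e, _⟩ | ⟨e, _⟩⟩
    · cases hs
    · exact ih _ hs
    · cases e
    · cases e

theorem SN.lam {M : Term} (h : SN M) : SN (.lam M) := by
  induction h with
  | intro M _ ih =>
    refine ⟨_, fun Q h => ?_⟩
    cases h with
    | lam h => exact ih _ h

theorem SN.named (a : ℕ) {M : Term} (h : SN M) : SN (.named a M) := by
  induction h with
  | intro M _ ih =>
    refine ⟨_, fun Q h => ?_⟩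
    cases h with
    | named _ h => exact ih _ h

/-- An induction principle for strongly normalizing terms, where the term may be reduced in any
positive number of steps. -/
theorem SN.induction_trans {C : Term → Prop} {M : Term} (h : SN M)
    (ih : ∀ M, SN M → (∀ M', Relation.TransGen Step M M' → C M') → C M) : C M := by
  have key : ∀ M, SN M → ∀ M', Steps M M' → C M' := by
    intro M hM
    induction hM with
    | intro M hM ihM =>
      have step : ∀ M', Relation.TransGen Step M M' → C M' := by
        intro M' hs
        obtain ⟨P, h₁, h₂⟩ := Relation.TransGen.head'_iff.1 hs
        exact ihM _ h₁ _ h₂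
      intro M' hs
      rcases Relation.reflTransGen_iff_eq_or_transGen.1 hs with rfl | hs
      · exact ih _ ⟨_, hM⟩ step
      · exact step _ hs
  exact key M h M .refl

/-- Main induction on the contractum, inner induction on the stack. The inner one serves when
reducing an argument leaves the contractum unchanged, for instance when the argument is erased. -/
theorem SN.lam_apps {M N : Term} {π : List Term} (hπ : StackSN (N :: π))
    (h : SN ((M.inst N).apps π)) : SN ((Term.lam M).apps (N :: π)) := by
  generalize hX : (M.inst N).apps π = X at h
  refine SN.induction_trans (C := fun X => ∀ M N π, StackSN (N :: π) → (M.inst N).apps π = X →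
    SN ((Term.lam M).apps (N :: π))) h ?_ M N π hπ hX
  clear hX hπ M N π
  intro X hXsn ih M N π hπ hX
  generalize hρ : N :: π = ρ at hπ
  induction hπ generalizing N π with
  | intro ρ hacc ih' =>
    subst hρ
    refine ⟨_, fun Q h => ?_⟩
    rcases h.apps_inv with ⟨_, hs, rfl⟩ | ⟨ρ', h', rfl⟩ | ⟨_, _, _, e, ⟨e', rfl⟩ | ⟨e', _⟩⟩
    · cases hs with
      | lam hs =>
        refine ih _ ?_ _ _ _ ⟨_, hacc⟩ rfl
        subst hX
        refine .single (Step.apps ?_ _)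
        simp only [Term.inst_eq_sub]
        exact hs.sub _ _
    · have hs := h'.forall₂
      cases hs with
      | @cons _ N' _ π' h₁ h₂ =>
        have hst : Steps X ((M.inst N').apps π') := by
          subst hX
          refine Steps.apps ?_ h₂
          simp only [Term.inst_eq_sub]
          refine M.sub_steps ?_ fun a => ⟨rfl, .nil⟩
          rintro (_ | n)
          · exact h₁
          · exact .refl
        rcases Relation.reflTransGen_iff_eq_or_transGen.1 hst with e | hst
        · exact ih' _ h' _ _ e rfl
        · exact ih _ hst _ _ _ (hacc _ h') rfl
    · cases e; cases e'
      exact hX ▸ hXsn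
    · cases e'

/-- Let `X` be the body with the whole stack pushed at once. Induction is on `X`, then on the length
of the stack, then on its reductions: contracting the head μ-redex keeps `X`, by
`Term.muSubst_push`, but consumes one argument. -/
theorem SN.mu_apps {M : Term} {π : List Term} (hπ : StackSN π)
    (h : SN (M.sub .var (pushMu 0 (π.map Term.shiftMu)))) : SN ((Term.mu M).apps π) := by
  generalize hX : M.sub .var (pushMu 0 (π.map Term.shiftMu)) = X at h
  refine SN.induction_trans (C := fun X => ∀ M π, StackSN π →
    M.sub .var (pushMu 0 (π.map Term.shiftMu)) = X → SN ((Term.mu M).apps π)) h ?_ M π hπ hX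
  clear hX hπ M π
  intro X hXsn ih M π hπ hX
  generalize hn : π.length = n
  induction n using Nat.strong_induction_on generalizing M π with
  | _ n ihn =>
  induction hπ with
  | intro π hacc ih' =>
    refine ⟨_, fun Q h => ?_⟩
    rcases h.apps_inv with ⟨_, hs, rfl⟩ | ⟨ρ', h', rfl⟩ | ⟨_, _, _, e, ⟨e', rfl⟩ | ⟨e', rfl⟩⟩
    · cases hs with
      | mu hs =>
        refine ih _ ?_ _ _ ⟨_, hacc⟩ rfl
        subst hX
        exact .single (hs.sub _ _)
    · have hst : Steps X (M.sub .var (pushMu 0 (ρ'.map Term.shiftMu))) := by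
        subst hX
        refine M.sub_steps (fun _ => .refl) fun a => ⟨rfl, ?_⟩
        simp only [pushMu]
        split_ifs
        · exact Forall₂.map_steps (fun _ _ h => h.rename _ _) h'.forall₂
        · exact .nil
      rcases Relation.reflTransGen_iff_eq_or_transGen.1 hst with e | hst
      · exact ih' _ h' e (h'.length_eq.trans hn)
      · exact ih _ hst _ _ (hacc _ h') rfl
    · cases e'
    · cases e'
      have hsn : StackSN π := ⟨_, hacc⟩
      subst e
      refine ihn _ ?_ _ _ hsn.tail ?_ rfl
      · rw [← hn]; exact Nat.lt_succ_self _
      · rw [Term.muSubst_push]; exact hX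

/-! ### Interpretation of types by sets of stacks -/

/-- The set of the strongly normalizing stacks. -/
def allStacks : Set (List Term) := {π | StackSN π}

theorem nil_le_allStacks : ({[]} : Set (List Term)) ≤ allStacks := by
  rintro _ rfl; exact .nil

/-- The sets of strongly normalizing stacks that contain the empty stack. -/
abbrev Cand : Type := Set.Icc ({[]} : Set (List Term)) allStacks

noncomputable instance : CompleteLattice Cand :=
  @Set.Icc.completeLattice _ _ _ _ ⟨nil_le_allStacks⟩

/-- The terms whose application to each stack of `X` is strongly normalizing. -/
def Cand.terms (X : Cand) : Set Term := {M | ∀ π ∈ X.1, SN (M.apps π)}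

theorem Cand.nil_mem (X : Cand) : [] ∈ X.1 := X.2.1 rfl

theorem Cand.stackSN (X : Cand) {π : List Term} (h : π ∈ X.1) : StackSN π := X.2.2 h

theorem Cand.terms_anti {X Y : Cand} (h : X ≤ Y) : Y.terms ⊆ X.terms :=
  fun _ hM _ hπ => hM _ (h hπ)

/-- The two bounds on candidates have dual roles: the empty stack makes realizers strongly
normalizing, and strong normalization of the stacks makes variables realizers. -/
theorem Cand.sn (X : Cand) {M : Term} (h : M ∈ X.terms) : SN M := h [] X.nil_mem

theorem Cand.var_mem (X : Cand) (x : ℕ) : .var x ∈ X.terms :=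
  fun _ hπ => SN.var_apps x (X.stackSN hπ)

/-- The candidate with the empty stack only. -/
def Cand.base : Cand := ⟨{[]}, le_rfl, nil_le_allStacks⟩

/-- The candidate of an arrow type. -/
def Cand.arr (X Y : Cand) : Cand :=
  ⟨{π | π = [] ∨ ∃ N ρ, π = N :: ρ ∧ N ∈ X.terms ∧ ρ ∈ Y.1}, fun _ h => .inl h, by
    rintro _ (rfl | ⟨N, ρ, rfl, hN, hρ⟩)
    · exact .nil
    · exact .cons (X.sn hN) (Y.stackSN hρ)⟩

theorem Cand.arr_mono {X X' Y Y' : Cand} (h : X' ≤ X) (h' : Y ≤ Y') : X.arr Y ≤ X'.arr Y' := by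
  rintro _ (rfl | ⟨N, ρ, rfl, hN, hρ⟩)
  · exact .inl rfl
  · exact .inr ⟨N, ρ, rfl, terms_anti h hN, h' hρ⟩

/-- The interpretation of types, given that of the type variables. -/
def interp {A I : Type*} (v : I → Cand) : Ty A I → Cand
  | .bot => .base
  | .atom _ => .base
  | .var i => v i
  | .arr U V => (interp v U).arr (interp v V)

theorem interp_eq {A I : Type*} {F : I → Ty A I} {v : I → Cand} (hv : ∀ i, v i = interp v (F i))
    {U V : Ty A I} (h : TyEq F U V) : interp v U = interp v V := by
  induction h with
  | eqn i => exact hv i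
  | refl => rfl
  | symm _ ih => exact ih.symm
  | trans _ _ ih₁ ih₂ => exact ih₁.trans ih₂
  | arr _ _ ih₁ ih₂ => simp only [interp, ih₁, ih₂]

/-- Adequacy of the interpretation. -/
theorem HasType.sub_mem {A I : Type*} {F : I → Ty A I} {v : I → Cand}
    (hv : ∀ i, v i = interp v (F i)) {Γ Δ : List (Ty A I)} {M : Term} {U : Ty A I}
    (h : HasType (TyEq F) Γ Δ M U) (σ : ℕ → Term) (κ : ℕ → ℕ × List Term)
    (hσ : ∀ n U, Γ[n]? = some U → σ n ∈ (interp v U).terms)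
    (hκ : ∀ a U, Δ[a]? = some U → (κ a).2 ∈ (interp v U).1) :
    M.sub σ κ ∈ (interp v U).terms := by
  induction h generalizing σ κ with
  | ax h => exact hσ _ _ h
  | conv _ h ih => exact interp_eq hv h ▸ ih σ κ hσ hκ
  | @lam Γ Δ M U V _ ih =>
    have key : ∀ N ∈ (interp v U).terms,
        (M.sub (liftSubst σ) (shiftLamMu κ)).inst N ∈ (interp v V).terms := by
      intro N hN
      rw [Term.sub_lift_inst]
      refine ih _ _ ?_ hκ
      rintro (_ | n) W hW
      · cases hW; exact hN
      · exact hσ n W hW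
    rintro _ (rfl | ⟨N, ρ, rfl, hN, hρ⟩)
    -- Against the empty stack, the body is tested on a variable, a realizer of every type. It need
    -- not be fresh, since substitution reflects strong normalization.
    · refine SN.lam ?_
      have := Cand.sn _ (key _ (Cand.var_mem _ 0))
      rw [Term.inst_eq_sub] at this
      exact SN.of_image (φ := Term.sub (single (.var 0)) idMu) (fun _ _ h => h.sub _ _) this
    · exact SN.lam_apps (.cons (Cand.sn _ hN) (Cand.stackSN _ hρ)) (key N hN ρ hρ)
  | app _ _ ih₁ ih₂ =>
    intro π hπ
    exact ih₁ σ κ hσ hκ (_ :: π) (.inr ⟨_, π, rfl, ih₂ σ κ hσ hκ, hπ⟩)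
  | @mu Γ Δ M U _ ih =>
    intro π hπ
    refine SN.mu_apps (Cand.stackSN _ hπ) ?_
    rw [Term.sub_push]
    -- Undoing the shift merges the bound name `0` with the free name `0`. This is harmless:
    -- reflecting strong normalization needs no injectivity, and the induction hypothesis constrains
    -- only the stacks, not the target names.
    refine SN.of_image (φ := Term.rename id Nat.pred) (fun _ _ h => h.rename _ _) ?_
    have shift_pred (P : Term) : P.shiftMu.rename id Nat.pred = P := by
      rw [Term.shiftMu, Term.rename_rename, Term.rename_eq_sub]; exact P.sub_id
    have := Cand.sn _ (ih σ (fun | 0 => (0, π) | n + 1 => κ n) hσ (by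
      rintro (_ | n) W hW
      · cases hW; exact hπ
      · exact hκ n W hW))
    rw [Term.rename_sub]
    convert this using 1
    refine congrArg₂ (fun σ κ => M.sub σ κ) ?_ ?_
    · funext x; exact shift_pred _
    · funext n; cases n <;> simp [shift_pred, Function.comp_def]
  | @named Γ Δ a M U h _ ih =>
    rintro _ rfl
    exact SN.named _ (ih σ κ hσ hκ _ (hκ a U h))

/-! ### Systems of signed monotone equations -/

/-- `x ≤ y` or `y ≤ x`, according to the sign. -/
def signedLE {L : Type*} [LE L] (s : Bool) (x y : L) : Prop := if s then x ≤ y else y ≤ x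

/-- The families `v` and `w` compare at each index with the signs that `S` allows there. -/
def SignedRel {I L : Type*} [LE L] (S : I → Bool → Prop) (v w : I → L) : Prop :=
  ∀ j s, S j s → signedLE s (v j) (w j)

/-- Here `s == t` is the product of signs; a negative dependence exchanges the two families. -/
theorem SignedRel.of_trans {I L : Type*} [LE L] {R : I → I → Bool → Prop}
    (htrans : ∀ i j k s t, R i j s → R j k t → R i k (s == t)) {i j : I} {s : Bool}
    (hij : R i j s) {v w : I → L} (h : SignedRel (R i) v w) :
    if s then SignedRel (R j) v w else SignedRel (R j) w v := by
  cases s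
  · intro k t ht
    have := h k _ (htrans _ _ _ _ _ hij ht)
    cases t <;> exact this
  · intro k t ht
    have := h k _ (htrans _ _ _ _ _ hij ht)
    cases t <;> exact this

/-- A finite system of equations in a complete lattice has a solution if every unknown depends on
itself monotonically only. -/
theorem exists_solution {I L : Type*} [CompleteLattice L] [Finite I] {R : I → I → Bool → Prop}
    (htrans : ∀ i j k s t, R i j s → R j k t → R i k (s == t)) (hpos : ∀ i, ¬ R i i false)
    (Φ : I → (I → L) → L) (hΦ : ∀ i v w, SignedRel (R i) v w → Φ i v ≤ Φ i w) :
    ∃ v : I → L, ∀ i, v i = Φ i v := by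
  classical
  -- `sol v` solves the equations indexed by `s`, with the other unknowns as parameters read from
  -- `v`. The third clause, signed monotonicity in the parameters, is what allows the next unknown
  -- to be eliminated.
  have key : ∀ s : Finset I, ∃ sol : (I → L) → I → L,
      (∀ v, ∀ i ∉ s, sol v i = v i) ∧ (∀ v, ∀ i ∈ s, sol v i = Φ i (sol v)) ∧
      ∀ i ∈ s, ∀ v w, SignedRel (R i) v w → sol v i ≤ sol w i := by
    intro s
    induction s using Finset.induction_on with
    | empty => exact ⟨id, by simp⟩
    | insert a s ha ih =>
      obtain ⟨sol, hout, hin, hmono⟩ := ih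
      have rel : ∀ i v w, SignedRel (R i) v w → SignedRel (R i) (sol v) (sol w) := by
        intro i v w h j t hj
        by_cases hjs : j ∈ s
        · have := h.of_trans htrans hj
          cases t
          · exact hmono j hjs _ _ this
          · exact hmono j hjs _ _ this
        · rw [hout _ _ hjs, hout _ _ hjs]; exact h j t hj
      have upd : ∀ (i : I) (v w : I → L) (x y : L), SignedRel (R i) v w →
          (∀ t, R i a t → signedLE t x y) →
          SignedRel (R i) (Function.update v a x) (Function.update w a y) := by
        intro i v w x y h hxy j t hj
        by_cases hja : j = a
        · subst hja; simpa using hxy t hj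
        · simpa [hja] using h j t hj
      -- The equation for `a` once the unknowns in `s` are solved as functions of `x`. It is
      -- monotone in `x` because `hpos` excludes a negative dependence of `a` on itself.
      let Ψ (v : I → L) : L →o L :=
        ⟨fun x => Φ a (sol (Function.update v a x)), fun x y hxy => hΦ a _ _ <| rel a _ _ <|
          upd a _ _ _ _ (fun _ t _ => by cases t <;> exact le_rfl) fun t ht => by
            cases t
            · exact absurd ht (hpos a)
            · exact hxy⟩
      have lfp_mono : ∀ v w, SignedRel (R a) v w → (Ψ v).lfp ≤ (Ψ w).lfp := fun v w h =>
        OrderHom.lfp.monotone fun x => hΦ a _ _ <| rel a _ _ <| upd a _ _ _ _ h fun t _ => by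
          cases t <;> exact le_rfl
      have lfp_rel : ∀ i (v w : I → L), SignedRel (R i) v w → ∀ t, R i a t →
          signedLE t (Ψ v).lfp (Ψ w).lfp := by
        intro i v w h t ht
        have := h.of_trans htrans ht
        cases t
        · exact lfp_mono _ _ this
        · exact lfp_mono _ _ this
      have sol_a : ∀ v, sol (Function.update v a (Ψ v).lfp) a = (Ψ v).lfp := fun v => by
        rw [hout _ _ ha, Function.update_self]
      refine ⟨fun v => sol (Function.update v a (Ψ v).lfp), ?_, ?_, ?_⟩
      · intro v i hi
        rw [Finset.mem_insert, not_or] at hi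
        beta_reduce
        rw [hout _ _ hi.2, Function.update_of_ne hi.1]
      · intro v i hi
        rcases Finset.mem_insert.1 hi with rfl | hi
        · exact (sol_a v).trans (Ψ v).map_lfp.symm
        · exact hin _ _ hi
      · intro i hi v w h
        rcases Finset.mem_insert.1 hi with rfl | hi
        · simp only [sol_a]; exact lfp_mono _ _ h
        · exact hmono i hi _ _ (upd i _ _ _ _ h (lfp_rel i v w h))
  have := Fintype.ofFinite I
  obtain ⟨sol, -, hin, -⟩ := key Finset.univ
  exact ⟨sol fun _ => ⊥, fun i => hin _ i (Finset.mem_univ i)⟩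

/-! ### Signed occurrences of type variables -/

/-- `Occ X s T`: the variable `X` has an occurrence of sign `s` in `T`. -/
inductive Occ {A I : Type*} (X : I) : Bool → Ty A I → Prop
  | self : Occ X true (.var X)
  | left {s : Bool} {U : Ty A I} (V : Ty A I) : Occ X (!s) U → Occ X s (.arr U V)
  | right {s : Bool} (U : Ty A I) {V : Ty A I} : Occ X s V → Occ X s (.arr U V)

theorem Polar.eq_of_occ {A I : Type*} {X : I} {s t : Bool} {T : Ty A I} (h : Polar X t T)
    (ho : Occ X s T) : s = t := by
  induction ho generalizing t with
  | self =>
    cases h with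
    | self => rfl
    | var _ h => exact absurd rfl h
  | left V _ ih =>
    cases h with
    | arr h _ => simpa using ih h
  | right U _ ih =>
    cases h with
    | arr _ h => exact ih h

/-- Replacing the given occurrence of `X` by `T'` multiplies the signs. This makes signed dependence
between variables transitive. -/
theorem Occ.replace {A I : Type*} {F : I → Ty A I} {X Z : I} {s t : Bool} {T T' : Ty A I}
    (h : Occ X s T) (hX : TyEq F (.var X) T') (h' : Occ Z t T') :
    ∃ T'', TyEq F T T'' ∧ Occ Z (s == t) T'' := by
  induction h with
  | self => exact ⟨T', hX, by simpa using h'⟩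
  | @left s U V _ ih =>
    obtain ⟨T'', h₁, h₂⟩ := ih
    refine ⟨.arr T'' V, .arr h₁ (.refl V), .left _ ?_⟩
    cases s <;> cases t <;> exact h₂
  | right U _ ih =>
    obtain ⟨T'', h₁, h₂⟩ := ih
    exact ⟨.arr U T'', .arr (.refl U) h₁, .right _ h₂⟩

theorem interp_le {A I : Type*} (T : Ty A I) {v w : I → Cand}
    (h : SignedRel (fun j s => Occ j s T) v w) : interp v T ≤ interp w T := by
  induction T generalizing v w with
  | bot => exact le_rfl
  | atom a => exact le_rfl
  | var i => exact h i true .self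
  | arr U V ihU ihV =>
    refine Cand.arr_mono (ihU fun j s hs => ?_) (ihV fun j s hs => h j s (.right _ hs))
    have := h j (!s) (.left _ (by simpa using hs))
    cases s <;> exact this

/-- `X i` depends on `X j` with sign `s` if `X j` occurs with sign `s` in some type equivalent to `X
i`. Quantifying over the whole class, not just `F i`, gives transitivity, and goodness excludes
negative self-dependence. -/
theorem Good.exists_interp {A I : Type*} [Finite I] {F : I → Ty A I} (hgood : Good (TyEq F)) :
    ∃ v : I → Cand, ∀ i, v i = interp v (F i) := by
  refine exists_solution (R := fun i j s => ∃ T, TyEq F (.var i) T ∧ Occ j s T) ?_ ?_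
    (fun i v => interp v (F i)) ?_
  · rintro i j k s t ⟨T, hT, ho⟩ ⟨T', hT', ho'⟩
    obtain ⟨T'', h, ho''⟩ := ho.replace hT' ho'
    exact ⟨T'', hT.trans h, ho''⟩
  · rintro i ⟨T, hT, ho⟩
    exact Bool.false_ne_true ((hgood i T hT).eq_of_occ ho)
  · exact fun i v w h => interp_le _ fun j s hs => h j s ⟨F i, .eqn i, hs⟩

theorem HasType.sn {A I : Type*} [Finite I] {F : I → Ty A I} (hgood : Good (TyEq F))
    {Γ Δ : List (Ty A I)} {M : Term} {U : Ty A I} (h : HasType (TyEq F) Γ Δ M U) : SN M := by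
  obtain ⟨v, hv⟩ := hgood.exists_interp
  have := h.sub_mem hv .var idMu (fun n U _ => Cand.var_mem _ n) (fun a U _ => Cand.nil_mem _)
  rw [Term.sub_id] at this
  exact Cand.sn _ this

theorem HasType.sn_inst {A I : Type*} [Finite I] {F : I → Ty A I} (hgood : Good (TyEq F))
    {Γ Δ : List (Ty A I)} {M N : Term} {U V : Ty A I} (hM : HasType (TyEq F) (U :: Γ) Δ M V)
    (hN : HasType (TyEq F) Γ Δ N U) : SN (M.inst N) :=
  (HasType.sn hgood (.app (.lam hM) hN)).step (.beta M N)

end LamMu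

theorem mainTheorem2 {A I : Type*} [Finite I] (F : I → LamMu.Ty A I)
    (hgood : LamMu.Good (LamMu.TyEq F)) :
    (∀ Y : Set I, (∀ i ∈ Y, LamMu.SubstSN (LamMu.TyEq F) {LamMu.Ty.var i}) →
        LamMu.SubstSN (LamMu.TyEq F) (LamMu.typesOver A Y)) ∧
    (∀ (i : I) (Γ Δ : List (LamMu.Ty A I)) (M N : LamMu.Term) (U : LamMu.Ty A I),
        LamMu.HasType (LamMu.TyEq F) (LamMu.Ty.var i :: Γ) Δ M U →
        LamMu.HasType (LamMu.TyEq F) Γ Δ N (LamMu.Ty.var i) →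
        LamMu.SN M → LamMu.SN N → LamMu.SN (M.inst N)) ∧
    (∀ (Γ Δ : List (LamMu.Ty A I)) (M : LamMu.Term) (U : LamMu.Ty A I),
        LamMu.HasType (LamMu.TyEq F) Γ Δ M U → LamMu.SN M) :=
  ⟨fun _ _ _ _ _ _ _ _ _ _ _ hM hN => hM.sn_inst hgood hN,
    fun _ _ _ _ _ _ hM hN _ _ => hM.sn_inst hgood hN,
    fun _ _ _ _ h => h.sn hgood⟩
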